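/- Let $n\ge 2$ and $I=(0,1)$. For an immersed curve $\gamma\in W^{2,2}(I;\mathbf{R}^n)$ (identified with its $C^1([0,1])$ representative) write $\partial_s=|\partial_x\gamma|^{-1}\partial_x$, $ds=|\partial_x\gamma|\,dx$, $\kappa=\gamma_{ss}$, and let $$\mathcal L[\gamma]=\int_I ds,\qquad \mathcal B[\gamma]=\int_I|\kappa|^2\,ds,\qquad \mathcal E_\lambda[\gamma]=\mathcal B[\gamma]+\lambda\mathcal L[\gamma].$$ For a clamped datum $\Gamma=(P_0,P_1,V_0,V_1)\in\mathbf{R}^n\times\mathbf{R}^n\times\mathbf{S}^{n-1}\times\mathbf{S}^{n-1}$ and $L>0$, let $\mathcal A_{\Gamma,L}$ be the set of $\gamma\in W^{2,2}(I;\mathbf{R}^n)$ with $\gamma(0)=P_0$, $\gamma(1)=P_1$, $\gamma_s(0)=V_0$, $\gamma_s(1)=V_1$, and $|\partial_x\gamma|\equiv\mathcal L[\gamma]=L$; let $\mathcal A_\Gamma=\bigcup_{L>0}\mathcal A_{\Gamma,L}$. **Theorem.** For every clamped datum $\Gamma$ and every $\lambda>0$ there is a minimizer of $\mathcal E_\lambda$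 in $\mathcal A_\Gamma$, that is, some $\gamma\in\mathcal A_\Gamma$ with $\mathcal E_\lambda[\gamma]\le\mathcal E_\lambda[\eta]$ for all $\eta\in\mathcal A_\Gamma$. Moreover, if $P_0=P_1$ and $V_0=V_1$, then $\mathcal A_\Gamma$ contains a once-covered, constant-speed parametrized circle of radius $1/\sqrt\lambda$, and every such circle in $\mathcal A_\Gamma$ is a minimizer of $\mathcal E_\lambda$ in $\mathcal A_\Gamma$. -/

import Mathlib

open scoped ContDiff
open MeasureTheory

noncomputable section

namespace Elastica

/-- Euclidean space `ℝⁿ`. -/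
abbrev Euc (n : ℕ) : Type := EuclideanSpace ℝ (Fin n)

/-- The parameter interval `I = (0,1)`. -/
abbrev I : Set ℝ := Set.Ioo 0 1

/-- The closed parameter interval `[0,1]`. -/
abbrev clI : Set ℝ := Set.Icc 0 1

/-- `v` is a weak derivative of `u` on `I`: both are locally integrable on `I`, and
`∫ φ' u = - ∫ φ v` for every real test function `φ ∈ C_c^∞(I)`. -/
def HasWeakDeriv {n : ℕ} (u v : ℝ → Euc n) : Prop :=
  LocallyIntegrableOn u I ∧ LocallyIntegrableOn v I ∧
    ∀ φ : ℝ → ℝ, ContDiff ℝ ∞ φ → HasCompactSupport φ → tsupport φ ⊆ I →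
      ∫ x in I, deriv φ x • u x = - ∫ x in I, φ x • v x

/-- Weak derivatives are unique almost everywhere on `I`. -/
theorem HasWeakDeriv.ae_eq {n : ℕ} {u v w : ℝ → Euc n}
    (hv : HasWeakDeriv u v) (hw : HasWeakDeriv u w) : v =ᵐ[volume.restrict I] w := by
  have hloc : LocallyIntegrableOn (fun x => v x - w x) I := hv.2.1.sub hw.2.1
  have hint : ∀ f : ℝ → Euc n, LocallyIntegrableOn f I → ∀ g : ℝ → ℝ, ContDiff ℝ ∞ g →
      HasCompactSupport g → tsupport g ⊆ I → Integrable (fun x => g x • f x) := by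
    intro f hf g hg hc hs
    have h1 : IntegrableOn f (tsupport g) := hf.integrableOn_compact_subset hs hc
    have h2 : IntegrableOn (fun x => g x • f x) (tsupport g) :=
      h1.continuousOn_smul hg.continuous.continuousOn hc
    rwa [integrableOn_iff_integrable_of_support_subset] at h2
    intro x hx
    apply subset_tsupport g
    intro h0
    apply hx
    simp [h0]
  have key := isOpen_Ioo.ae_eq_zero_of_integral_contDiff_smul_eq_zero hloc (by
    intro g hg hc hs
    have e : ∀ f : ℝ → Euc n, ∫ x in I, g x • f x = ∫ x, g x • f x := by
      intro f
      apply setIntegral_eq_integral_of_forall_compl_eq_zero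
      intro x hx
      have : g x = 0 := by
        by_contra h
        exact hx (hs (subset_tsupport g h))
      simp [this]
    have h1 := hv.2.2 g hg hc hs
    have h2 := hw.2.2 g hg hc hs
    rw [h1] at h2
    rw [e, e] at h2
    simp only [smul_sub]
    rw [integral_sub (hint v hv.2.1 g hg hc hs) (hint w hw.2.1 g hg hc hs)]
    exact sub_eq_zero.2 (neg_injective h2))
  rw [Filter.EventuallyEq, ae_restrict_iff' measurableSet_Ioo]
  filter_upwards [key] with x hx hxI
  exact sub_eq_zero.1 (hx hxI)

open Classical in
/-- The weak derivative of `u` on `I` (a representative of it; the value is `0` if `u` has no weak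
derivative). -/
def weakDeriv {n : ℕ} (u : ℝ → Euc n) : ℝ → Euc n :=
  if h : ∃ v, HasWeakDeriv u v then h.choose else 0

/-- `γ` is (the continuous representative on `[0,1]` of) an element of `W^{2,2}(I; ℝⁿ)`: it is
continuous on `[0,1]`, and it and its first two weak derivatives on `I` are in `L²(I; ℝⁿ)`.
Values of `γ` outside `[0,1]` play no role. -/
def MemW22 {n : ℕ} (γ : ℝ → Euc n) : Prop :=
  ContinuousOn γ clI ∧ MemLp γ 2 (volume.restrict I) ∧
    ∃ u v : ℝ → Euc n, HasWeakDeriv γ u ∧ MemLp u 2 (volume.restrict I) ∧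
      HasWeakDeriv u v ∧ MemLp v 2 (volume.restrict I)

/-- `∂ₓγ` on `[0,1]`, one-sided at the endpoints. Since `W^{2,2}(I) ⊂ C¹([0,1])`, this is the
continuous representative of the weak derivative of a curve of class `W^{2,2}`. -/
def velocity {n : ℕ} (γ : ℝ → Euc n) (x : ℝ) : Euc n := derivWithin γ clI x

/-- The unit tangent `γ_s = |∂ₓγ|⁻¹ ∂ₓγ`. -/
def tangent {n : ℕ} (γ : ℝ → Euc n) (x : ℝ) : Euc n := ‖velocity γ x‖⁻¹ • velocity γ x

/-- The curvature vector `κ = γ_ss = |∂ₓγ|⁻¹ ∂ₓ(γ_s)`, defined almost everywhere on `I`. -/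
def curvature {n : ℕ} (γ : ℝ → Euc n) (x : ℝ) : Euc n :=
  ‖velocity γ x‖⁻¹ • weakDeriv (tangent γ) x

/-- The length `L[γ] = ∫_I ds`, with `ds = |∂ₓγ| dx`. -/
def length {n : ℕ} (γ : ℝ → Euc n) : ℝ := ∫ x in I, ‖velocity γ x‖

/-- The bending energy `B[γ] = ∫_I |κ|² ds`. -/
def bending {n : ℕ} (γ : ℝ → Euc n) : ℝ := ∫ x in I, ‖curvature γ x‖ ^ 2 * ‖velocity γ x‖

/-- The modified bending energy `E_λ = B + λ L`. -/
def energy {n : ℕ} (lam : ℝ) (γ : ℝ → Euc n) : ℝ := bending γ + lam * length γ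

/-- A clamped datum `Γ = (P₀, P₁, V₀, V₁) ∈ ℝⁿ × ℝⁿ × 𝕊ⁿ⁻¹ × 𝕊ⁿ⁻¹`. -/
structure ClampedDatum (n : ℕ) where
  P₀ : Euc n
  P₁ : Euc n
  V₀ : Euc n
  V₁ : Euc n
  norm_V₀ : ‖V₀‖ = 1
  norm_V₁ : ‖V₁‖ = 1

/-- The set `A_{Γ,L}` of constant-speed `W^{2,2}` curves of length `L` with clamped datum `Γ`. -/
def admissibleOfLength {n : ℕ} (Γ : ClampedDatum n) (L : ℝ) : Set (ℝ → Euc n) :=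
  {γ | MemW22 γ ∧ γ 0 = Γ.P₀ ∧ γ 1 = Γ.P₁ ∧ tangent γ 0 = Γ.V₀ ∧ tangent γ 1 = Γ.V₁ ∧
    (∀ x ∈ clI, ‖velocity γ x‖ = length γ) ∧ length γ = L}

/-- The set `A_Γ = ⋃_{L > 0} A_{Γ,L}`. -/
def admissible {n : ℕ} (Γ : ClampedDatum n) : Set (ℝ → Euc n) :=
  ⋃ L ∈ Set.Ioi (0 : ℝ), admissibleOfLength Γ L

/-- `γ` minimizes `E_λ` in `A_Γ`. -/
def IsMinimizer {n : ℕ} (Γ : ClampedDatum n) (lam : ℝ) (γ : ℝ → Euc n) : Prop :=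
  γ ∈ admissible Γ ∧ ∀ η ∈ admissible Γ, energy lam γ ≤ energy lam η

/-- `γ` runs once, at constant speed, around a round circle of radius `r` in some plane of `ℝⁿ`. -/
def IsCircle {n : ℕ} (r : ℝ) (γ : ℝ → Euc n) : Prop :=
  ∃ c u w : Euc n, ‖u‖ = 1 ∧ ‖w‖ = 1 ∧ inner ℝ u w = 0 ∧
    ∀ x ∈ clI, γ x =
      c + (r * Real.cos (2 * Real.pi * x)) • u + (r * Real.sin (2 * Real.pi * x)) • w

end Elastica

end

namespace Elastica

/-! A constant-speed curve of class `W^{2,2}` is determined by its starting point, its speed `L` and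
the derivative `g ∈ L²` of its unit tangent. In these variables the energy is `L⁻¹ ‖g‖² + λ L`.
Admissibility means that the tangent `V₀ + ∫₀ˣ g` has norm one for every `x`, equals `V₁` at `x =
1`, and has `L` times its mean equal to `P₁ - P₀`. `exists_represents` and
`Represents.mem_admissible` translate between the two descriptions.

Existence is the direct method (`exists_min_reducedEnergy`). On an energy sublevel, `L` is bounded
above since `λ > 0`, and `g` is bounded in `L²`. The speed also stays away from zero: short curves
joining distinct points are impossible with bounded `L`-scaling, and a closed curve must turn, which
costs energy of order `1 / L`. Weakly in `g`, balls are compact, the energy is lower semicontinuous,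
and the constraints are closed because they involve `g` only through continuous linear maps into a
finite-dimensional space. The admissible class is nonempty since arcs of unit circles and a segment
can be concatenated to meet any datum (`exists_joins`).

When the datum closes up, the tangent is a unit-length periodic function of mean zero. Wirtinger's
inequality gives `‖g‖² ≥ 4π²`, so the energy is at least `4π² / L + λ L ≥ 4π√λ`, which is the energy
of a circle of radius `1 / √λ`. -/

/-! ### Weak derivatives and primitives on the unit interval -/

/-- Integration by parts for the primitive of an integrable function. -/
theorem integral_deriv_smul_primitive {𝕜 E : Type*} [RCLike 𝕜] [NormedAddCommGroup E]
    [NormedSpace ℝ E] [NormedSpace 𝕜 E] [CompleteSpace E] {φ φ' : ℝ → 𝕜} {g : ℝ → E}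
    (hφ : ∀ x, HasDerivAt φ (φ' x) x) (hφ' : Continuous φ')
    (hg : IntervalIntegrable g volume 0 1) :
    ∫ x in (0 : ℝ)..1, φ' x • ∫ t in (0 : ℝ)..x, g t =
      φ 1 • (∫ t in (0 : ℝ)..1, g t) - ∫ t in (0 : ℝ)..1, φ t • g t := by
  have hg' : IntegrableOn g (Set.Ioc 0 1) := by
    rwa [intervalIntegrable_iff_integrableOn_Ioc_of_le zero_le_one] at hg
  have hφc : Continuous φ := continuous_iff_continuousAt.2 fun x => (hφ x).continuousAt
  have hφi : IntegrableOn φ' (Set.Ioc 0 1) :=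
    (hφ'.intervalIntegrable 0 1).1
  -- The integrand is cut off to the triangle `t ≤ x`, so that Fubini exchanges the two integrals.
  let F : ℝ → ℝ → E := fun x t => Set.indicator {z : ℝ × ℝ | z.2 ≤ z.1}
    (fun z => φ' z.1 • g z.2) (x, t)
  have hF : Integrable (Function.uncurry F)
      ((volume.restrict (Set.Ioc 0 1)).prod (volume.restrict (Set.Ioc 0 1))) := by
    have := (hφi.integrable.smul_prod hg'.integrable).indicator
      (measurableSet_le measurable_snd measurable_fst)
    exact this
  have hswap := integral_integral_swap hF
  have hleft : ∀ x ∈ Set.Ioc (0 : ℝ) 1,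
      ∫ t in Set.Ioc (0 : ℝ) 1, F x t = φ' x • ∫ t in (0 : ℝ)..x, g t := by
    intro x hx
    rw [intervalIntegral.integral_of_le hx.1.le, ← integral_smul]
    have : ∀ t, F x t = Set.indicator (Set.Iic x) (fun t => φ' x • g t) t := by
      intro t; by_cases h : t ≤ x <;> simp [F, Set.indicator, h]
    simp_rw [this]
    rw [setIntegral_indicator measurableSet_Iic]
    congr 2
    ext t; simp only [Set.mem_inter_iff, Set.mem_Ioc, Set.mem_Iic]
    constructor
    · rintro ⟨⟨a, _⟩, b⟩; exact ⟨a, b⟩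
    · rintro ⟨a, b⟩; exact ⟨⟨a, b.trans hx.2⟩, b⟩
  have hright : ∀ t ∈ Set.Ioc (0 : ℝ) 1,
      ∫ x in Set.Ioc (0 : ℝ) 1, F x t = φ 1 • g t - φ t • g t := by
    intro t ht
    have : ∀ x, F x t = Set.indicator (Set.Ici t) (fun x => φ' x • g t) x := by
      intro x; by_cases h : t ≤ x <;> simp [F, Set.indicator, h]
    simp_rw [this]
    rw [setIntegral_indicator measurableSet_Ici, integral_smul_const, ← sub_smul]
    congr 1
    have hs : Set.Ioc (0 : ℝ) 1 ∩ Set.Ici t = Set.Icc t 1 := by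
      ext x; simp only [Set.mem_inter_iff, Set.mem_Ioc, Set.mem_Ici, Set.mem_Icc]
      constructor
      · rintro ⟨⟨_, a⟩, b⟩; exact ⟨b, a⟩
      · rintro ⟨a, b⟩; exact ⟨⟨ht.1.trans_le a, b⟩, a⟩
    rw [hs, integral_Icc_eq_integral_Ioc, ← intervalIntegral.integral_of_le ht.2]
    exact intervalIntegral.integral_eq_sub_of_hasDerivAt (fun x _ => hφ x)
      (hφ'.intervalIntegrable _ _)
  rw [intervalIntegral.integral_of_le zero_le_one, intervalIntegral.integral_of_le zero_le_one,
    intervalIntegral.integral_of_le zero_le_one, ← setIntegral_congr_fun measurableSet_Ioc hleft,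
    hswap, setIntegral_congr_fun measurableSet_Ioc hright, integral_sub, integral_smul]
  · exact hg'.integrable.smul (φ 1)
  · have := (hg'.continuousOn_smul_of_subset (K := Set.Icc (0 : ℝ) 1) hφc.continuousOn
      isCompact_Icc measurableSet_Ioc Set.Ioc_subset_Icc_self)
    exact this

theorem integral_I_eq {E : Type*} [NormedAddCommGroup E] [NormedSpace ℝ E] (f : ℝ → E) :
    ∫ x in I, f x = ∫ x in (0 : ℝ)..1, f x := by
  rw [intervalIntegral.integral_of_le zero_le_one, integral_Ioc_eq_integral_Ioo]

theorem intervalIntegrable_of_integrableOn_I {E : Type*} [NormedAddCommGroup E] {f : ℝ → E}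
    (hf : IntegrableOn f I) {a b : ℝ} (ha : a ∈ clI) (hb : b ∈ clI) :
    IntervalIntegrable f volume a b := by
  have h : IntervalIntegrable f volume 0 1 := by
    rw [intervalIntegrable_iff_integrableOn_Ioo_of_le zero_le_one]; exact hf
  apply h.mono_set
  rw [Set.uIcc_of_le (zero_le_one' ℝ)]
  exact Set.uIcc_subset_Icc ha hb

theorem continuousOn_primitive {E : Type*} [NormedAddCommGroup E] [NormedSpace ℝ E]
    {f : ℝ → E} (hf : IntegrableOn f I) :
    ContinuousOn (fun x => ∫ t in (0 : ℝ)..x, f t) clI := by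
  have h := intervalIntegral.continuousOn_primitive_interval (a := (0 : ℝ)) (b := 1) (f := f)
    (μ := volume) (by
      rw [Set.uIcc_of_le (zero_le_one' ℝ), integrableOn_Icc_iff_integrableOn_Ioo]; exact hf)
  rwa [Set.uIcc_of_le (zero_le_one' ℝ)] at h

theorem integrableOn_I_of_continuousOn {E : Type*} [NormedAddCommGroup E]
    {f : ℝ → E} (hf : ContinuousOn f clI) : IntegrableOn f I :=
  (hf.integrableOn_compact isCompact_Icc).mono_set Set.Ioo_subset_Icc_self

theorem memLp_I_of_continuousOn {E : Type*} [NormedAddCommGroup E] {f : ℝ → E}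
    (hf : ContinuousOn f clI) : MemLp f 2 (volume.restrict I) := by
  obtain ⟨C, hC⟩ := isCompact_Icc.exists_bound_of_continuousOn hf
  refine MemLp.of_bound (integrableOn_I_of_continuousOn hf).aestronglyMeasurable C ?_
  filter_upwards [ae_restrict_mem measurableSet_Ioo] with x hx
  exact hC x (Set.Ioo_subset_Icc_self hx)

/-- A primitive has the integrand as weak derivative. -/
theorem hasWeakDeriv_primitive {n : ℕ} {u g : ℝ → Euc n} (c : Euc n) (hg : IntegrableOn g I)
    (hu : ∀ᵐ x ∂volume.restrict I, u x = c + ∫ t in (0 : ℝ)..x, g t) : HasWeakDeriv u g := by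
  have hU : IntegrableOn (fun x => c + ∫ t in (0 : ℝ)..x, g t) I :=
    integrableOn_I_of_continuousOn (continuousOn_const.add (continuousOn_primitive hg))
  refine ⟨IntegrableOn.locallyIntegrableOn (hU.congr (hu.mono fun x hx => hx.symm)),
    hg.locallyIntegrableOn, fun φ hφ hc hs => ?_⟩
  have h0 : φ 0 = 0 := image_eq_zero_of_notMem_tsupport fun h => lt_irrefl _ (hs h).1
  have h1 : φ 1 = 0 := image_eq_zero_of_notMem_tsupport fun h => lt_irrefl _ (hs h).2
  have hd : ∀ x, HasDerivAt φ (deriv φ x) x := fun x =>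
    ((hφ.differentiable (by simp)) x).hasDerivAt
  have hdc : Continuous (deriv φ) := hφ.continuous_deriv (by simp)
  have e : ∫ x in I, deriv φ x • u x = ∫ x in I, deriv φ x • (c + ∫ t in (0 : ℝ)..x, g t) :=
    integral_congr_ae (hu.mono fun x hx => by simp only [hx])
  have hgI := intervalIntegrable_of_integrableOn_I hg (a := 0) (b := 1) (by simp) (by simp)
  rw [e, integral_I_eq, integral_I_eq]
  simp only [smul_add]
  rw [intervalIntegral.integral_add, integral_deriv_smul_primitive hd hdc hgI,
    intervalIntegral.integral_smul_const,
    intervalIntegral.integral_eq_sub_of_hasDerivAt (fun x _ => hd x)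
      (hdc.intervalIntegrable _ _), h0, h1]
  · simp
  · exact (hdc.smul continuous_const).intervalIntegrable _ _
  · apply intervalIntegrable_of_integrableOn_I _ (by simp) (by simp)
    exact integrableOn_I_of_continuousOn (hdc.continuousOn.smul (continuousOn_primitive hg))

/-- A smooth function with compact support in `I` and vanishing integral has a primitive which is
again a test function. -/
theorem exists_testFunction_primitive {θ : ℝ → ℝ} (hθ : ContDiff ℝ ∞ θ)
    (hs : tsupport θ ⊆ I) (h0 : ∫ x in I, θ x = 0) :
    ∃ Φ : ℝ → ℝ, ContDiff ℝ ∞ Φ ∧ HasCompactSupport Φ ∧ tsupport Φ ⊆ I ∧ deriv Φ = θ := by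
  have hc : IsCompact (tsupport θ) :=
    isCompact_Icc.of_isClosed_subset (isClosed_tsupport θ) (hs.trans Set.Ioo_subset_Icc_self)
  obtain ⟨a, b, ha, hb, hab⟩ : ∃ a b : ℝ, 0 < a ∧ b < 1 ∧ tsupport θ ⊆ Set.Icc a b := by
    by_cases hne : (tsupport θ).Nonempty
    · exact ⟨sInf (tsupport θ), sSup (tsupport θ), (hs (hc.sInf_mem hne)).1,
        (hs (hc.sSup_mem hne)).2, fun x hx =>
        ⟨csInf_le hc.bddBelow hx, le_csSup hc.bddAbove hx⟩⟩
    · rw [Set.not_nonempty_iff_eq_empty] at hne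
      exact ⟨1 / 2, 1 / 2, by norm_num, by norm_num, by simp [hne]⟩
  have hz : ∀ x, x ∉ Set.Icc a b → θ x = 0 := fun x hx =>
    image_eq_zero_of_notMem_tsupport fun h => hx (hab h)
  have hd : ∀ x, HasDerivAt (fun x => ∫ t in (0 : ℝ)..x, θ t) (θ x) x := fun x =>
    intervalIntegral.integral_hasDerivAt_right (hθ.continuous.intervalIntegrable _ _)
      (hθ.continuous.stronglyMeasurableAtFilter _ _) hθ.continuous.continuousAt
  have hderiv : deriv (fun x => ∫ t in (0 : ℝ)..x, θ t) = θ := funext fun x => (hd x).deriv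
  -- To the left of `a` nothing has been integrated yet; to the right of `b` the whole integral has,
  -- and it is zero by `h0`.
  have hout : ∀ x, x ∉ Set.Icc a b → ∫ t in (0 : ℝ)..x, θ t = 0 := by
    intro x hx
    rcases lt_or_ge x a with h | h
    · rw [intervalIntegral.integral_congr (g := fun _ => 0), intervalIntegral.integral_zero]
      intro t ht
      exact hz t fun h' => absurd h'.1 (not_le.2 (ht.2.trans_lt (max_lt ha h)))
    · have hbx : b < x := by by_contra hh; exact hx ⟨h, not_lt.1 hh⟩
      rw [integral_I_eq] at h0
      rw [← intervalIntegral.integral_add_adjacent_intervals (b := 1)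
        (hθ.continuous.intervalIntegrable _ _) (hθ.continuous.intervalIntegrable _ _), h0,
        intervalIntegral.integral_congr (g := fun _ => 0), intervalIntegral.integral_zero, add_zero]
      intro t ht
      exact hz t fun h' => absurd h'.2 (not_le.2 ((lt_min hb hbx).trans_le ht.1))
  have hts : tsupport (fun x => ∫ t in (0 : ℝ)..x, θ t) ⊆ Set.Icc a b :=
    closure_minimal (fun x hx => by by_contra h; exact hx (hout x h)) isClosed_Icc
  refine ⟨fun x => ∫ t in (0 : ℝ)..x, θ t, ?_, HasCompactSupport.intro isCompact_Icc hout,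
    hts.trans fun x hx => ⟨ha.trans_le hx.1, hx.2.trans_lt hb⟩, hderiv⟩
  rw [contDiff_infty_iff_deriv, hderiv]
  exact ⟨fun x => (hd x).differentiableAt, hθ⟩

theorem integrable_smul_of_tsupport_subset {E : Type*} [NormedAddCommGroup E] [NormedSpace ℝ E]
    {f : ℝ → E} (hf : LocallyIntegrableOn f I) {g : ℝ → ℝ} (hg : Continuous g)
    (hs : tsupport g ⊆ I) (hc : HasCompactSupport g) : Integrable (fun x => g x • f x) := by
  have h1 : IntegrableOn f (tsupport g) := hf.integrableOn_compact_subset hs hc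
  have h2 : IntegrableOn (fun x => g x • f x) (tsupport g) :=
    h1.continuousOn_smul hg.continuousOn hc
  rwa [integrableOn_iff_integrable_of_support_subset] at h2
  intro x hx
  apply subset_tsupport g
  intro h0
  apply hx
  simp [h0]

theorem integral_I_smul_eq {E : Type*} [NormedAddCommGroup E] [NormedSpace ℝ E]
    (f : ℝ → E) {g : ℝ → ℝ} (hs : tsupport g ⊆ I) : ∫ x in I, g x • f x = ∫ x, g x • f x := by
  apply setIntegral_eq_integral_of_forall_compl_eq_zero
  intro x hx
  simp [image_eq_zero_of_notMem_tsupport fun h => hx (hs h)]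

/-- A function with vanishing weak derivative is almost everywhere constant. -/
theorem HasWeakDeriv.ae_eq_const {n : ℕ} {z : ℝ → Euc n} (hz : HasWeakDeriv z 0) :
    ∃ c : Euc n, ∀ᵐ x ∂volume.restrict I, z x = c := by
  let B : ContDiffBump (1 / 2 : ℝ) := ⟨1 / 8, 1 / 4, by norm_num, by norm_num⟩
  let η : ℝ → ℝ := B.normed volume
  have hη : ContDiff ℝ ∞ η := B.contDiff_normed
  have hηc : HasCompactSupport η := B.hasCompactSupport_normed
  have hηs : tsupport η ⊆ I := by
    rw [show tsupport η = Metric.closedBall (1 / 2) (1 / 4) from B.tsupport_normed_eq,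
      Real.closedBall_eq_Icc]
    intro x hx
    constructor <;> [have := hx.1; have := hx.2] <;> norm_num at this <;> linarith
  have hη1 : ∫ x, η x = 1 := B.integral_normed
  have hone : ∀ {g : ℝ → ℝ}, tsupport g ⊆ I → ∫ x in I, g x = ∫ x, g x := fun {g} hg => by
    have := integral_I_smul_eq (fun _ => (1 : ℝ)) hg
    simpa using this
  refine ⟨∫ x, η x • z x, ?_⟩
  set c := ∫ x, η x • z x
  have hloc : LocallyIntegrableOn (fun x => z x - c) I :=
    hz.1.sub (locallyIntegrableOn_const c)
  have key := isOpen_Ioo.ae_eq_zero_of_integral_contDiff_smul_eq_zero hloc (by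
    intro ψ hψ hψc hψs
    set m := ∫ x, ψ x
    -- Subtracting `m * η` makes the mean of `ψ` vanish, so `ψ - m * η` is the derivative of a test
    -- function, against which `z` integrates to zero. Hence `∫ ψ z = m c`, with `c` the `η`-average
    -- of `z`.
    have hθs : tsupport (fun x => ψ x - m * η x) ⊆ I := by
      refine (closure_minimal (t := tsupport ψ ∪ tsupport η) ?_
        ((isClosed_tsupport _).union (isClosed_tsupport _))).trans (Set.union_subset hψs hηs)
      intro x hx
      by_contra h
      rw [Set.mem_union, not_or] at h
      apply hx
      simp [image_eq_zero_of_notMem_tsupport h.1, image_eq_zero_of_notMem_tsupport h.2]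
    have hψi : Integrable ψ := hψ.continuous.integrable_of_hasCompactSupport hψc
    have hηi : Integrable η := hη.continuous.integrable_of_hasCompactSupport hηc
    obtain ⟨Φ, h1, h2, h3, h4⟩ := exists_testFunction_primitive
      (θ := fun x => ψ x - m * η x) (hψ.sub (contDiff_const.mul hη)) hθs (by
        rw [hone hθs, integral_sub hψi (hηi.const_mul m), integral_const_mul, hη1]
        simp [m])
    have h5 := hz.2.2 Φ h1 h2 h3
    rw [h4] at h5
    rw [integral_I_smul_eq _ hθs] at h5
    simp only [sub_smul, mul_smul, Pi.zero_apply, smul_zero, integral_zero, neg_zero] at h5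
    have i1 := integrable_smul_of_tsupport_subset hz.1 hψ.continuous hψs hψc
    have i2 := integrable_smul_of_tsupport_subset hz.1 hη.continuous hηs hηc
    have i3 : Integrable (fun x => m • η x • z x) := i2.smul m
    rw [integral_sub i1 i3, integral_smul] at h5
    simp only [smul_sub]
    rw [integral_sub i1 (hψi.smul_const c), integral_smul_const]
    exact h5)
  rw [ae_restrict_iff' measurableSet_Ioo]
  filter_upwards [key] with x hx hxI
  exact sub_eq_zero.1 (hx hxI)

/-- Fundamental theorem of calculus for weak derivatives. -/
theorem HasWeakDeriv.exists_ae_eq_primitive {n : ℕ} {u v : ℝ → Euc n} (h : HasWeakDeriv u v)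
    (hv : IntegrableOn v I) :
    ∃ c : Euc n, ∀ᵐ x ∂volume.restrict I, u x = c + ∫ t in (0 : ℝ)..x, v t := by
  have hw := hasWeakDeriv_primitive (u := fun x => ∫ t in (0 : ℝ)..x, v t) 0 hv (by simp)
  have hz : HasWeakDeriv (fun x => u x - ∫ t in (0 : ℝ)..x, v t) 0 := by
    refine ⟨h.1.sub hw.1, locallyIntegrableOn_zero, fun φ hφ hc hs => ?_⟩
    have hφ' : Continuous (deriv φ) := hφ.continuous_deriv (by simp)
    have hs' : tsupport (deriv φ) ⊆ I := tsupport_deriv_subset.trans hs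
    simp only [smul_sub]
    rw [integral_sub, h.2.2 φ hφ hc hs, hw.2.2 φ hφ hc hs]
    · simp
    · exact (integrable_smul_of_tsupport_subset h.1 hφ' hs' hc.deriv).integrableOn
    · exact (integrable_smul_of_tsupport_subset hw.1 hφ' hs' hc.deriv).integrableOn
  obtain ⟨c, hc⟩ := hz.ae_eq_const
  exact ⟨c, hc.mono fun x hx => by rw [← hx]; simp⟩

/-! ### Wirtinger's inequality -/

/-- Wirtinger's inequality for complex-valued functions. -/
theorem wirtinger_complex {f g : ℝ → ℂ} (c : ℂ) (hg : MemLp g 2 (volume.restrict I))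
    (hf : ∀ x ∈ clI, f x = c + ∫ t in (0 : ℝ)..x, g t) (hper : ∫ t in (0 : ℝ)..1, g t = 0)
    (hmean : ∫ x in (0 : ℝ)..1, f x = 0) :
    4 * Real.pi ^ 2 * ∫ x in (0 : ℝ)..1, ‖f x‖ ^ 2 ≤ ∫ x in (0 : ℝ)..1, ‖g x‖ ^ 2 := by
  have hgI : IntegrableOn g I := hg.integrable one_le_two
  have hg01 : IntervalIntegrable g volume 0 1 :=
    intervalIntegrable_of_integrableOn_I hgI (by simp) (by simp)
  have hfc : ContinuousOn f clI :=
    (continuousOn_const.add (continuousOn_primitive hgI)).congr hf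
  have hf2 : MemLp f 2 (volume.restrict (Set.Ioc 0 1)) := by
    rw [← Measure.restrict_congr_set (Ioo_ae_eq_Ioc (μ := volume))]
    exact memLp_I_of_continuousOn hfc
  have hg2 : MemLp g 2 (volume.restrict (Set.Ioc 0 1)) := by
    rwa [← Measure.restrict_congr_set (Ioo_ae_eq_Ioc (μ := volume))]
  -- By Parseval it suffices to compare the squared Fourier coefficients mode by mode.
  have Sf := (hasSum_sq_fourierCoeffOn (zero_lt_one' ℝ) hf2).mul_left (4 * Real.pi ^ 2)
  have Sg := hasSum_sq_fourierCoeffOn (zero_lt_one' ℝ) hg2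
  have hle := hasSum_le (fun k => ?_) Sf Sg
  · simpa using hle
  have hcoef : ∀ h : ℝ → ℂ, fourierCoeffOn (zero_lt_one' ℝ) h k =
      ∫ x in (0 : ℝ)..1, fourier (-k) (x : AddCircle ((1 : ℝ) - 0)) • h x := by
    intro h; rw [fourierCoeffOn_eq_integral]; simp
  by_cases hk : k = 0
  · have : fourierCoeffOn (zero_lt_one' ℝ) f k = 0 := by
      rw [hcoef, hk]; simpa using hmean
    rw [this]; simp
  let φ : ℝ → ℂ := fun x => fourier (-k) (x : AddCircle ((1 : ℝ) - 0))
  let φ' : ℝ → ℂ := fun x => -2 * Real.pi * Complex.I * k / ((1 : ℝ) - 0 : ℝ) * φ x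
  have hφ : ∀ x, HasDerivAt φ (φ' x) x := fun x => hasDerivAt_fourier_neg ((1 : ℝ) - 0) k x
  have hφc : Continuous φ := continuous_iff_continuousAt.2 fun x => (hφ x).continuousAt
  have hφ'c : Continuous φ' := continuous_const.mul hφc
  have hφ1 : φ 1 = φ 0 := by
    have : ((1 : ℝ) : AddCircle ((1 : ℝ) - 0)) = ((0 : ℝ) : AddCircle ((1 : ℝ) - 0)) := by
      simp
    simp only [φ, this]
  -- The boundary term vanishes because `g` has integral zero; the constant `c` drops out because
  -- `φ` is periodic. What remains is `2πik f̂(k) = ĝ(k)`.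
  have hibp := integral_deriv_smul_primitive hφ hφ'c hg01
  rw [hper, smul_zero, zero_sub] at hibp
  have e1 : ∫ x in (0 : ℝ)..1, φ' x • f x = - ∫ t in (0 : ℝ)..1, φ t • g t := by
    rw [← hibp, intervalIntegral.integral_congr (g := fun x => φ' x • c +
      φ' x • ∫ t in (0 : ℝ)..x, g t), intervalIntegral.integral_add,
      intervalIntegral.integral_smul_const,
      intervalIntegral.integral_eq_sub_of_hasDerivAt (fun x _ => hφ x)
      (hφ'c.intervalIntegrable _ _), hφ1]
    · simp
    · exact (hφ'c.smul continuous_const).intervalIntegrable _ _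
    · apply intervalIntegrable_of_integrableOn_I _ (by simp) (by simp)
      exact integrableOn_I_of_continuousOn (hφ'c.continuousOn.smul (continuousOn_primitive hgI))
    · intro x hx
      rw [Set.uIcc_of_le zero_le_one] at hx
      simp only [hf x hx, smul_add]
  have e2 : (-2 * Real.pi * Complex.I * k) * fourierCoeffOn (zero_lt_one' ℝ) f k =
      - fourierCoeffOn (zero_lt_one' ℝ) g k := by
    rw [hcoef, hcoef, ← e1, ← intervalIntegral.integral_const_mul]
    congr 1; ext x; simp [φ', φ, mul_assoc]
  have e3 := congrArg (fun z => ‖z‖ ^ 2) e2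
  simp only [norm_mul, norm_neg, Complex.norm_I, Complex.norm_real, Complex.norm_ofNat,
    Complex.norm_intCast, mul_one, mul_pow, Real.norm_eq_abs, sq_abs] at e3
  rw [← e3]
  have hk1 : (1 : ℝ) ≤ (k : ℝ) ^ 2 := by
    have : (1 : ℤ) ≤ k ^ 2 := by have := sq_pos_of_ne_zero hk; omega
    exact_mod_cast this
  have : 0 ≤ Real.pi ^ 2 * ‖fourierCoeffOn (zero_lt_one' ℝ) f k‖ ^ 2 := by positivity
  nlinarith

/-- Wirtinger's inequality for vector-valued functions. -/
theorem wirtinger {n : ℕ} {f g : ℝ → Euc n} (c : Euc n) (hg : MemLp g 2 (volume.restrict I))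
    (hf : ∀ x ∈ clI, f x = c + ∫ t in (0 : ℝ)..x, g t) (hper : ∫ t in (0 : ℝ)..1, g t = 0)
    (hmean : ∫ x in (0 : ℝ)..1, f x = 0) :
    4 * Real.pi ^ 2 * ∫ x in I, ‖f x‖ ^ 2 ≤ ∫ x in I, ‖g x‖ ^ 2 := by
  have hgI : IntegrableOn g I := hg.integrable one_le_two
  have hfc : ContinuousOn f clI :=
    (continuousOn_const.add (continuousOn_primitive hgI)).congr hf
  have hf2 : MemLp f 2 (volume.restrict I) :=
    memLp_I_of_continuousOn hfc
  -- The inequality is summed over real coordinates, each regarded as complex-valued.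
  let P : Fin n → Euc n →L[ℝ] ℂ := fun i =>
    Complex.ofRealCLM.comp (EuclideanSpace.proj (𝕜 := ℝ) i)
  have hP : ∀ i v, P i v = ((v i : ℝ) : ℂ) := fun i v => rfl
  have hnorm : ∀ v : Euc n, ‖v‖ ^ 2 = ∑ i, ‖P i v‖ ^ 2 := fun v => by
    rw [EuclideanSpace.norm_sq_eq]; simp [hP]
  have hint : ∀ {h : ℝ → Euc n}, MemLp h 2 (volume.restrict I) → ∀ i,
      IntegrableOn (fun x => ‖P i (h x)‖ ^ 2) I := fun {h} hh i =>
    ((P i).comp_memLp' hh).integrable_norm_pow two_ne_zero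
  simp only [hnorm]
  rw [integral_finsetSum _ fun i _ => hint hf2 i, integral_finsetSum _ fun i _ => hint hg i,
    Finset.mul_sum]
  refine Finset.sum_le_sum fun i _ => ?_
  rw [integral_I_eq, integral_I_eq]
  have hI : ∀ {h : ℝ → Euc n}, IntegrableOn h I → ∀ {x : ℝ}, x ∈ clI →
      ∫ t in (0 : ℝ)..x, P i (h t) = P i (∫ t in (0 : ℝ)..x, h t) := fun {h} hh {x} hx =>
    (P i).intervalIntegral_comp_comm (intervalIntegrable_of_integrableOn_I hh (by simp) hx)
  refine wirtinger_complex (P i c) ((P i).comp_memLp' hg) (fun x hx => ?_) ?_ ?_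
  · rw [hf x hx, map_add, hI hgI hx]
  · rw [hI hgI (by simp), hper, map_zero]
  · rw [hI (integrableOn_I_of_continuousOn hfc) (by simp), hmean, map_zero]

/-! ### Curves described by their speed and tangent derivative -/

/-- The `W^{1,2}` function on `[0,1]` with initial value `c` and weak derivative `g`. -/
noncomputable def direction {n : ℕ} (c : Euc n) (g : ℝ → Euc n) (x : ℝ) : Euc n :=
  c + ∫ t in (0 : ℝ)..x, g t

/-- `γ` has constant speed `L > 0`, its unit tangent starts from `c` and has derivative `g ∈ L²`. -/
structure Represents {n : ℕ} (γ : ℝ → Euc n) (L : ℝ) (c : Euc n) (g : ℝ → Euc n) : Prop where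
  pos : 0 < L
  memLp : MemLp g 2 (volume.restrict I)
  unit : ∀ x ∈ clI, ‖direction c g x‖ = 1
  curve : ∀ x ∈ clI, γ x = γ 0 + L • ∫ t in (0 : ℝ)..x, direction c g t

theorem continuousOn_direction {n : ℕ} {c : Euc n} {g : ℝ → Euc n} (hg : IntegrableOn g I) :
    ContinuousOn (direction c g) clI :=
  continuousOn_const.add (continuousOn_primitive hg)

/-- The one-sided derivatives of the primitive of a continuous function. -/
theorem velocity_primitive {n : ℕ} {γ f : ℝ → Euc n} (a : Euc n) (hf : ContinuousOn f clI)
    (hγ : ∀ x ∈ clI, γ x = a + ∫ t in (0 : ℝ)..x, f t) {x : ℝ} (hx : x ∈ clI) :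
    velocity γ x = f x := by
  have : Fact (x ∈ Set.Icc (0 : ℝ) 1) := ⟨hx⟩
  have h := intervalIntegral.integral_hasDerivWithinAt_right (s := clI) (t := clI)
    (intervalIntegrable_of_integrableOn_I (integrableOn_I_of_continuousOn hf)
      (a := 0) (b := x) (by simp) hx)
    (hf.stronglyMeasurableAtFilter_nhdsWithin measurableSet_Icc x) (hf x hx)
  exact ((h.const_add a).congr hγ (hγ x hx)).derivWithin (uniqueDiffOn_Icc zero_lt_one x hx)

namespace Represents

variable {n : ℕ} {γ : ℝ → Euc n} {L : ℝ} {c : Euc n} {g : ℝ → Euc n}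

theorem integrableOn (h : Represents γ L c g) : IntegrableOn g I := h.memLp.integrable one_le_two

theorem curve' (h : Represents γ L c g) {x : ℝ} (hx : x ∈ clI) :
    γ x = γ 0 + ∫ t in (0 : ℝ)..x, L • direction c g t := by
  rw [h.curve x hx, intervalIntegral.integral_smul]

theorem continuousOn_smul_direction (h : Represents γ L c g) :
    ContinuousOn (fun x => L • direction c g x) clI :=
  (continuousOn_direction h.integrableOn).const_smul L

theorem velocity_eq (h : Represents γ L c g) {x : ℝ} (hx : x ∈ clI) :
    velocity γ x = L • direction c g x :=
  velocity_primitive (γ 0) h.continuousOn_smul_direction (fun _ hx => h.curve' hx) hx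

theorem norm_velocity (h : Represents γ L c g) {x : ℝ} (hx : x ∈ clI) : ‖velocity γ x‖ = L := by
  rw [h.velocity_eq hx, norm_smul, h.unit x hx, mul_one, Real.norm_of_nonneg h.pos.le]

theorem tangent_eq (h : Represents γ L c g) {x : ℝ} (hx : x ∈ clI) :
    tangent γ x = direction c g x := by
  rw [tangent, h.norm_velocity hx, h.velocity_eq hx, smul_smul, inv_mul_cancel₀ h.pos.ne',
    one_smul]

theorem length_eq (h : Represents γ L c g) : length γ = L := by
  rw [length, setIntegral_congr_fun (g := fun _ => L) measurableSet_Ioo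
    fun x hx => h.norm_velocity (Set.Ioo_subset_Icc_self hx)]
  simp

theorem weakDeriv_tangent (h : Represents γ L c g) :
    weakDeriv (tangent γ) =ᵐ[volume.restrict I] g := by
  have hw : HasWeakDeriv (tangent γ) g := by
    refine hasWeakDeriv_primitive c h.integrableOn ?_
    filter_upwards [ae_restrict_mem measurableSet_Ioo] with x hx
    exact h.tangent_eq (Set.Ioo_subset_Icc_self hx)
  have hex : ∃ v, HasWeakDeriv (tangent γ) v := ⟨g, hw⟩
  -- `weakDeriv` is an arbitrary choice, tied to `g` only by almost everywhere uniqueness.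
  rw [weakDeriv, dif_pos hex]
  exact hex.choose_spec.ae_eq hw

theorem bending_eq (h : Represents γ L c g) : bending γ = L⁻¹ * ∫ x in I, ‖g x‖ ^ 2 := by
  rw [bending, ← integral_const_mul]
  refine integral_congr_ae ?_
  filter_upwards [h.weakDeriv_tangent, ae_restrict_mem measurableSet_Ioo] with x hx hxI
  rw [curvature, h.norm_velocity (Set.Ioo_subset_Icc_self hxI), hx, norm_smul, norm_inv,
    Real.norm_of_nonneg h.pos.le]
  field_simp [h.pos.ne']

theorem energy_eq (h : Represents γ L c g) (lam : ℝ) :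
    energy lam γ = L⁻¹ * (∫ x in I, ‖g x‖ ^ 2) + lam * L := by
  rw [energy, h.bending_eq, h.length_eq]

theorem memW22 (h : Represents γ L c g) : MemW22 γ := by
  have hc : ContinuousOn γ clI :=
    (continuousOn_const.add (continuousOn_primitive
      (integrableOn_I_of_continuousOn h.continuousOn_smul_direction))).congr
      fun x hx => h.curve' hx
  refine ⟨hc, memLp_I_of_continuousOn hc, fun x => L • direction c g x, fun x => L • g x,
    hasWeakDeriv_primitive (γ 0)
      (integrableOn_I_of_continuousOn h.continuousOn_smul_direction) ?_,
    memLp_I_of_continuousOn h.continuousOn_smul_direction,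
    hasWeakDeriv_primitive (L • c) (h.integrableOn.smul L) ?_, h.memLp.const_smul L⟩
  · filter_upwards [ae_restrict_mem measurableSet_Ioo] with x hx
    exact h.curve' (Set.Ioo_subset_Icc_self hx)
  · refine Filter.Eventually.of_forall fun x => ?_
    rw [direction, smul_add, intervalIntegral.integral_smul]

theorem mem_admissible {Γ : ClampedDatum n} (h : Represents γ L Γ.V₀ g) (h0 : γ 0 = Γ.P₀)
    (h1 : direction Γ.V₀ g 1 = Γ.V₁)
    (h2 : L • ∫ t in (0 : ℝ)..1, direction Γ.V₀ g t = Γ.P₁ - Γ.P₀) : γ ∈ admissible Γ := by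
  simp only [admissible, Set.mem_iUnion]
  refine ⟨L, h.pos, h.memW22, h0, ?_, ?_, ?_, fun x hx => ?_, h.length_eq⟩
  · rw [h.curve 1 (by simp), h2, h0]; abel
  · rw [h.tangent_eq (by simp), direction]; simp
  · rw [h.tangent_eq (by simp), h1]
  · rw [h.norm_velocity hx, h.length_eq]

end Represents

/-- Continuous functions on `[0,1]` which agree almost everywhere agree everywhere. -/
theorem eqOn_clI_of_ae_eq {n : ℕ} {f g : ℝ → Euc n} (hf : ContinuousOn f clI)
    (hg : ContinuousOn g clI) (h : ∀ᵐ x ∂volume.restrict I, f x = g x) : Set.EqOn f g clI := by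
  have h1 : Set.EqOn f g I := Measure.eqOn_open_of_ae_eq h isOpen_Ioo
    (hf.mono Set.Ioo_subset_Icc_self) (hg.mono Set.Ioo_subset_Icc_self)
  exact h1.of_subset_closure hf hg Set.Ioo_subset_Icc_self (by rw [closure_Ioo zero_ne_one])

/-- Integrating the two weak derivatives turns `γ` into a double primitive of `v`, with a continuous
velocity. As the speed is the constant `L`, dividing that velocity by `L` gives the tangent, whose
derivative is `L⁻¹ • v`. -/
theorem exists_represents {n : ℕ} {Γ : ClampedDatum n} {γ : ℝ → Euc n}
    (hγ : γ ∈ admissible Γ) : ∃ (L : ℝ) (g : ℝ → Euc n), Represents γ L Γ.V₀ g ∧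
      direction Γ.V₀ g 1 = Γ.V₁ ∧
      L • ∫ t in (0 : ℝ)..1, direction Γ.V₀ g t = Γ.P₁ - Γ.P₀ := by
  simp only [admissible, Set.mem_iUnion] at hγ
  obtain ⟨L, hL, ⟨hc, _, u, v, hu, hu2, hv, hv2⟩, h0, h1, hV0, hV1, hspeed, hlen⟩ := hγ
  rw [Set.mem_Ioi] at hL
  have hvI : IntegrableOn v I := hv2.integrable one_le_two
  have huI : IntegrableOn u I := hu2.integrable one_le_two
  obtain ⟨b, hb⟩ := hv.exists_ae_eq_primitive hvI
  obtain ⟨a, ha⟩ := hu.exists_ae_eq_primitive huI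
  have hdc := continuousOn_direction (c := b) hvI
  have hprim : ∀ x ∈ clI, ∫ t in (0 : ℝ)..x, u t = ∫ t in (0 : ℝ)..x, direction b v t := by
    intro x hx
    rw [intervalIntegral.integral_of_le hx.1, intervalIntegral.integral_of_le hx.1,
      integral_Ioc_eq_integral_Ioo, integral_Ioc_eq_integral_Ioo]
    exact integral_congr_ae (ae_restrict_of_ae_restrict_of_subset
      (Set.Ioo_subset_Ioo le_rfl hx.2) hb)
  have hγ1 : ∀ x ∈ clI, γ x = a + ∫ t in (0 : ℝ)..x, direction b v t := by
    intro x hx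
    rw [← hprim x hx]
    exact eqOn_clI_of_ae_eq hc (continuousOn_const.add (continuousOn_primitive huI)) ha hx
  have ha0 : γ 0 = a := by rw [hγ1 0 (by simp)]; simp
  have hvel : ∀ x ∈ clI, velocity γ x = direction b v x := fun x hx =>
    velocity_primitive a hdc hγ1 hx
  have hnorm : ∀ x ∈ clI, ‖velocity γ x‖ = L := fun x hx => by rw [hspeed x hx, hlen]
  have hV : Γ.V₀ = L⁻¹ • b := by
    rw [← hV0, tangent, hnorm 0 (by simp), hvel 0 (by simp), direction]; simp
  have hdir : ∀ x, direction Γ.V₀ (fun t => L⁻¹ • v t) x = L⁻¹ • direction b v x := fun x => by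
    rw [direction, direction, intervalIntegral.integral_smul, hV, smul_add]
  have hint : ∀ x, L • ∫ t in (0 : ℝ)..x, direction Γ.V₀ (fun t => L⁻¹ • v t) t =
      ∫ t in (0 : ℝ)..x, direction b v t := fun x => by
    simp only [hdir]
    rw [intervalIntegral.integral_smul, smul_smul, mul_inv_cancel₀ hL.ne', one_smul]
  refine ⟨L, fun t => L⁻¹ • v t, ⟨hL, hv2.const_smul L⁻¹, fun x hx => ?_, fun x hx => ?_⟩, ?_, ?_⟩
  · rw [hdir, norm_smul, ← hvel x hx, hnorm x hx, norm_inv, Real.norm_of_nonneg hL.le,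
      inv_mul_cancel₀ hL.ne']
  · rw [hint, hγ1 x hx, ha0]
  · rw [hdir, ← hvel 1 (by simp), ← hV1, tangent, hnorm 1 (by simp)]
  · rw [hint, ← h1, ← h0, ha0, hγ1 1 (by simp)]; abel

/-! ### The constraints as bounded linear maps on `L²` -/

instance : IsProbabilityMeasure (volume.restrict I) := ⟨by simp⟩

/-- The Hilbert space `L²(I; ℝⁿ)`. -/
abbrev L2I (n : ℕ) : Type := Lp (Euc n) 2 (volume.restrict I)

variable {n : ℕ}

/-- On a probability space the `L¹` norm is at most the `L²` norm. The resulting constant one later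
gives the explicit lower bounds on the speed. -/
theorem norm_setIntegral_le_norm (s : Set ℝ) (g : L2I n) :
    ‖∫ t in s, g t ∂(volume.restrict I)‖ ≤ ‖g‖ := by
  have hg : MemLp g 2 (volume.restrict I) := Lp.memLp g
  have h1 : Integrable g (volume.restrict I) := hg.integrable one_le_two
  calc ‖∫ t in s, g t ∂(volume.restrict I)‖
      ≤ ∫ t in s, ‖g t‖ ∂(volume.restrict I) := norm_integral_le_integral_norm _
    _ ≤ ∫ t, ‖g t‖ ∂(volume.restrict I) :=
        setIntegral_le_integral h1.norm (Filter.Eventually.of_forall fun _ => norm_nonneg _)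
    _ = (eLpNorm g 1 (volume.restrict I)).toReal := by
        rw [eLpNorm_one_eq_lintegral_enorm, integral_norm_eq_lintegral_enorm h1.1]
    _ ≤ (eLpNorm g 2 (volume.restrict I)).toReal :=
        ENNReal.toReal_mono hg.2.ne (eLpNorm_le_eLpNorm_of_exponent_le one_le_two h1.1)
    _ = ‖g‖ := (Lp.norm_def g).symm

/-- The functional `g ↦ ∫₀ˣ g` on `L²(I; ℝⁿ)`. -/
noncomputable def primitiveCLM (n : ℕ) (x : ℝ) : L2I n →L[ℝ] Euc n :=
  LinearMap.mkContinuous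
    { toFun := fun g => ∫ t in Set.Ioo 0 x, g t ∂(volume.restrict I)
      map_add' := fun f g => by
        rw [← integral_add ((Lp.memLp f).integrable one_le_two).integrableOn
          ((Lp.memLp g).integrable one_le_two).integrableOn]
        exact integral_congr_ae (ae_restrict_of_ae (Lp.coeFn_add f g))
      map_smul' := fun a g => by
        rw [RingHom.id_apply, ← integral_smul]
        exact integral_congr_ae (ae_restrict_of_ae (Lp.coeFn_smul a g)) } 1
    fun g => by rw [one_mul]; exact norm_setIntegral_le_norm _ g

theorem norm_primitiveCLM_apply_le (x : ℝ) (g : L2I n) : ‖primitiveCLM n x g‖ ≤ ‖g‖ :=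
  norm_setIntegral_le_norm _ g

theorem primitiveCLM_apply {x : ℝ} (hx : x ∈ clI) (g : L2I n) :
    primitiveCLM n x g = ∫ t in (0 : ℝ)..x, g t := by
  rw [intervalIntegral.integral_of_le hx.1, integral_Ioc_eq_integral_Ioo]
  change ∫ t in Set.Ioo 0 x, g t ∂(volume.restrict I) = _
  rw [Measure.restrict_restrict measurableSet_Ioo,
    Set.inter_eq_left.2 (Set.Ioo_subset_Ioo le_rfl hx.2)]

theorem intervalIntegrable_primitiveCLM (g : L2I n) :
    IntervalIntegrable (fun x => primitiveCLM n x g) volume 0 1 := by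
  have h : ContinuousOn (fun x => primitiveCLM n x g) clI :=
    (continuousOn_primitive ((Lp.memLp g).integrable one_le_two)).congr
      fun x hx => primitiveCLM_apply hx g
  exact intervalIntegrable_of_integrableOn_I (integrableOn_I_of_continuousOn h) (by simp) (by simp)

/-- The functional `g ↦ ∫₀¹ ∫₀ˣ g` on `L²(I; ℝⁿ)`. -/
noncomputable def meanPrimitiveCLM (n : ℕ) : L2I n →L[ℝ] Euc n :=
  LinearMap.mkContinuous
    { toFun := fun g => ∫ x in (0 : ℝ)..1, primitiveCLM n x g
      map_add' := fun f g => by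
        rw [← intervalIntegral.integral_add (intervalIntegrable_primitiveCLM f)
          (intervalIntegrable_primitiveCLM g)]
        simp only [map_add]
      map_smul' := fun a g => by
        simp only [map_smul, intervalIntegral.integral_smul, RingHom.id_apply] } 1
    fun g => by
      have := intervalIntegral.norm_integral_le_of_norm_le_const (a := 0) (b := 1)
        (f := fun x => primitiveCLM n x g) (C := ‖g‖)
        fun x _ => norm_primitiveCLM_apply_le x g
      simpa using this

theorem meanPrimitiveCLM_apply (g : L2I n) :
    meanPrimitiveCLM n g = ∫ x in (0 : ℝ)..1, primitiveCLM n x g := rfl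

theorem norm_meanPrimitiveCLM_apply_le (g : L2I n) : ‖meanPrimitiveCLM n g‖ ≤ ‖g‖ := by
  have := intervalIntegral.norm_integral_le_of_norm_le_const (a := 0) (b := 1)
    (f := fun x => primitiveCLM n x g) (C := ‖g‖) fun x _ => norm_primitiveCLM_apply_le x g
  simpa [meanPrimitiveCLM_apply] using this

/-! ### Weak compactness and the direct method -/

section WeakCompactness

variable {H : Type*} [NormedAddCommGroup H] [InnerProductSpace ℝ H] [CompleteSpace H]

/-- The vector of a Hilbert space which represents a functional. -/
noncomputable def rieszVector (ψ : WeakDual ℝ H) : H :=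
  (InnerProductSpace.toDual ℝ H).symm (WeakDual.toStrongDual ψ)

theorem inner_rieszVector (ψ : WeakDual ℝ H) (h : H) : inner ℝ (rieszVector ψ) h = ψ h :=
  InnerProductSpace.toDual_symm_apply

theorem norm_rieszVector (ψ : WeakDual ℝ H) : ‖rieszVector ψ‖ = ‖WeakDual.toStrongDual ψ‖ :=
  LinearIsometryEquiv.norm_map _ _

theorem rieszVector_surjective : Function.Surjective (rieszVector (H := H)) := fun g =>
  ⟨WeakDual.toStrongDual.symm (InnerProductSpace.toDual ℝ H g), by simp [rieszVector]⟩

theorem continuous_inner_rieszVector (h : H) :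
    Continuous fun ψ : WeakDual ℝ H => inner ℝ (rieszVector ψ) h := by
  simp only [inner_rieszVector]
  exact WeakDual.eval_continuous h

/-- Each coordinate of `B` is an inner product with a fixed vector, by Riesz; finitely many weakly
continuous coordinates give norm continuity in the target. -/
theorem continuous_apply_rieszVector (B : H →L[ℝ] Euc n) :
    Continuous fun ψ : WeakDual ℝ H => B (rieszVector ψ) := by
  have hi : ∀ i, Continuous fun ψ : WeakDual ℝ H => (B (rieszVector ψ)) i := by
    intro i
    let b : H →L[ℝ] ℝ := (EuclideanSpace.proj (𝕜 := ℝ) i).comp B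
    have : ∀ ψ : WeakDual ℝ H, (B (rieszVector ψ)) i =
        inner ℝ (rieszVector ψ) ((InnerProductSpace.toDual ℝ H).symm b) := fun ψ => by
      rw [real_inner_comm, InnerProductSpace.toDual_symm_apply]; rfl
    simp only [this]
    exact continuous_inner_rieszVector _
  exact (PiLp.continuous_toLp 2 _).comp (continuous_pi hi)

/-- The reduced energy of a speed and a derivative of the tangent. -/
noncomputable def reducedEnergy (lam : ℝ) (p : ℝ × H) : ℝ := p.1⁻¹ * ‖p.2‖ ^ 2 + lam * p.1

theorem lowerSemicontinuousOn_reducedEnergy (lam : ℝ) :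
    LowerSemicontinuousOn (fun p : ℝ × WeakDual ℝ H => reducedEnergy lam (p.1, rieszVector p.2))
      {p | 0 < p.1} := by
  intro p hp y hy
  let h := rieszVector p.2
  -- Since `‖k‖² ≥ 2⟪k, h⟫ - ‖h‖²`, this is a weakly continuous minorant of the energy that touches
  -- it at `p`.
  let f : ℝ × WeakDual ℝ H → ℝ := fun q =>
    q.1⁻¹ * (2 * inner ℝ (rieszVector q.2) h - ‖h‖ ^ 2) + lam * q.1
  have hf : ContinuousAt f p := by
    refine ContinuousAt.add (ContinuousAt.mul (continuousAt_fst.inv₀ (ne_of_gt hp)) ?_)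
      (continuousAt_const.mul continuousAt_fst)
    exact ((continuous_const.mul ((continuous_inner_rieszVector h).comp continuous_snd)).sub
      continuous_const).continuousAt
  have hfp : f p = reducedEnergy lam (p.1, rieszVector p.2) := by
    simp only [f, h, reducedEnergy, real_inner_self_eq_norm_sq]; ring
  have hev : ∀ᶠ q in nhdsWithin p {p | 0 < p.1}, y < f q :=
    (hf.eventually (lt_mem_nhds (by rw [hfp]; exact hy))).filter_mono nhdsWithin_le_nhds
  filter_upwards [hev, self_mem_nhdsWithin] with q hq hq0
  refine hq.trans_le ?_
  have hq1 : 0 ≤ q.1⁻¹ := inv_nonneg.2 (le_of_lt hq0)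
  simp only [f, reducedEnergy]
  gcongr
  have := norm_sub_sq_real (rieszVector q.2) h
  nlinarith [sq_nonneg ‖rieszVector q.2 - h‖]

/-- Minimization of the reduced energy under weakly continuous constraints. -/
theorem exists_min_reducedEnergy (A : ℝ → H →L[ℝ] Euc n) (M : H →L[ℝ] Euc n)
    (hM : ∀ g, ‖M g‖ ≤ ‖g‖) {V W D : Euc n} (hV : ‖V‖ = 1) {lam : ℝ} (hlam : 0 < lam)
    {S : Set (ℝ × H)} (hS : S = {p | 0 < p.1 ∧ (∀ x ∈ clI, ‖V + A x p.2‖ = 1) ∧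
      V + A 1 p.2 = W ∧ p.1 • (V + M p.2) = D}) (hne : S.Nonempty) :
    ∃ p ∈ S, ∀ q ∈ S, reducedEnergy lam p ≤ reducedEnergy lam q := by
  obtain ⟨p₀, hp₀⟩ := hne
  set E := reducedEnergy lam p₀ with hE
  have hp₀pos : 0 < p₀.1 := by rw [hS] at hp₀; exact hp₀.1
  have hEpos : 0 < E := by rw [hE, reducedEnergy]; positivity
  -- The energy bound yields `‖g‖² ≤ E² / λ`; then `t ≤ 1 + t²` avoids a square root.
  set R := 1 + E ^ 2 / lam with hR
  have hRpos : 0 < R := by positivity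
  obtain ⟨c, hc, hcb⟩ : ∃ c : ℝ, 0 < c ∧ ∀ p ∈ S, reducedEnergy lam p ≤ E →
      c ≤ p.1 ∧ p.1 ≤ E / lam ∧ ‖p.2‖ ≤ R := by
    have key : ∀ p ∈ S, reducedEnergy lam p ≤ E →
        p.1 ≤ E / lam ∧ ‖p.2‖ ≤ R ∧ ‖p.2‖ ^ 2 ≤ E * p.1 := by
      intro p hp hpE
      rw [hS] at hp
      have hpos := hp.1
      rw [reducedEnergy] at hpE
      have h1 : 0 ≤ p.1⁻¹ * ‖p.2‖ ^ 2 := by positivity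
      have h2 : 0 < lam * p.1 := by positivity
      have h3 : p.1 ≤ E / lam := by rw [le_div_iff₀ hlam]; linarith
      have h4 : ‖p.2‖ ^ 2 ≤ E * p.1 := by
        have : p.1⁻¹ * ‖p.2‖ ^ 2 ≤ E := by linarith
        rwa [inv_mul_le_iff₀ hpos, mul_comm] at this
      have h5 : ‖p.2‖ ^ 2 ≤ E ^ 2 / lam := by
        calc ‖p.2‖ ^ 2 ≤ E * p.1 := h4
          _ ≤ E * (E / lam) := by gcongr
          _ = E ^ 2 / lam := by ring
      refine ⟨h3, ?_, h4⟩
      nlinarith [sq_nonneg (‖p.2‖ - 1), norm_nonneg p.2]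
    -- For `D = 0` the tangent has mean zero, so `M g = -V` and `1 ≤ ‖g‖² ≤ E L`. Otherwise `‖D‖ = L
    -- ‖V + M g‖ ≤ L (1 + R)`.
    by_cases hD : D = 0
    · refine ⟨1 / E, by positivity, fun p hp hpE => ?_⟩
      obtain ⟨h1, h2, h3⟩ := key p hp hpE
      refine ⟨?_, h1, h2⟩
      rw [hS] at hp
      obtain ⟨hpos, -, -, hmean⟩ := hp
      rw [hD, smul_eq_zero, or_iff_right hpos.ne', add_eq_zero_iff_eq_neg] at hmean
      have h4 : 1 ≤ ‖p.2‖ := by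
        calc (1 : ℝ) = ‖M p.2‖ := by rw [← norm_neg, ← hmean, hV]
          _ ≤ ‖p.2‖ := hM _
      rw [div_le_iff₀ hEpos]
      nlinarith
    · refine ⟨‖D‖ / (1 + R), by positivity, fun p hp hpE => ?_⟩
      obtain ⟨h1, h2, -⟩ := key p hp hpE
      refine ⟨?_, h1, h2⟩
      rw [hS] at hp
      obtain ⟨hpos, -, -, hmean⟩ := hp
      rw [div_le_iff₀ (by positivity), ← hmean, norm_smul, Real.norm_of_nonneg hpos.le]
      gcongr
      exact (norm_add_le _ _).trans (add_le_add hV.le ((hM _).trans h2))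
  -- Compact by Banach–Alaoglu, once the constraints are seen to be weakly closed. It contains the
  -- whole sublevel of `p₀`; competitors of energy above `E` lose to `p₀` itself.
  let K : Set (ℝ × WeakDual ℝ H) :=
    (Set.Icc c (E / lam) ×ˢ (WeakDual.toStrongDual ⁻¹' Metric.closedBall 0 R)) ∩
      {p | (∀ x ∈ clI, ‖V + A x (rieszVector p.2)‖ = 1) ∧
        V + A 1 (rieszVector p.2) = W ∧ p.1 • (V + M (rieszVector p.2)) = D}
  have hcont : ∀ B : H →L[ℝ] Euc n,
      Continuous fun p : ℝ × WeakDual ℝ H => V + B (rieszVector p.2) := fun B =>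
    continuous_const.add ((continuous_apply_rieszVector B).comp continuous_snd)
  have hK : IsCompact K := by
    refine (isCompact_Icc.prod (WeakDual.isCompact_closedBall 0 R)).inter_right ?_
    refine IsClosed.inter ?_ (IsClosed.inter ?_ ?_)
    · change IsClosed {p : ℝ × WeakDual ℝ H | ∀ x ∈ clI, ‖V + A x (rieszVector p.2)‖ = 1}
      simp only [Set.ofPred_forall]
      exact isClosed_biInter fun x _ => isClosed_eq (hcont (A x)).norm continuous_const
    · exact isClosed_eq (hcont (A 1)) continuous_const
    · exact isClosed_eq (continuous_fst.smul (hcont M)) continuous_const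
  have hmem : ∀ q ∈ S, reducedEnergy lam q ≤ E → ∃ p ∈ K, (p.1, rieszVector p.2) = q := by
    rintro ⟨L, g⟩ hq hqE
    obtain ⟨h1, h2, h3⟩ := hcb _ hq hqE
    obtain ⟨ψ, rfl⟩ := rieszVector_surjective g
    rw [hS] at hq
    refine ⟨(L, ψ), ⟨⟨⟨h1, h2⟩, ?_⟩, hq.2⟩, rfl⟩
    rw [Set.mem_preimage, mem_closedBall_zero_iff, ← norm_rieszVector]
    exact h3
  have hKS : ∀ p ∈ K, (p.1, rieszVector p.2) ∈ S := fun p hp => by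
    rw [hS]; exact ⟨hc.trans_le hp.1.1.1, hp.2⟩
  obtain ⟨k₀, hk₀, hk₀p⟩ := hmem p₀ hp₀ le_rfl
  obtain ⟨k, hk, hmin⟩ := ((lowerSemicontinuousOn_reducedEnergy lam).mono
    fun p (hp : p ∈ K) => hc.trans_le hp.1.1.1).exists_isMinOn ⟨k₀, hk₀⟩ hK
  rw [isMinOn_iff] at hmin
  refine ⟨_, hKS k hk, fun q hq => ?_⟩
  rcases le_or_gt (reducedEnergy lam q) E with h | h
  · obtain ⟨k', hk', rfl⟩ := hmem q hq h
    exact hmin k' hk'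
  · refine le_trans ?_ h.le
    have := hmin k₀ hk₀
    rwa [hk₀p] at this

end WeakCompactness

/-! ### Existence of an admissible curve -/

/-- There is a unit-speed curve of length `ℓ` and displacement `D`, with bounded curvature, whose
tangent turns from `V` to `W`. -/
def Joins (V W D : Euc n) (ℓ : ℝ) : Prop :=
  0 ≤ ℓ ∧ ∃ g : ℝ → Euc n, StronglyMeasurable g ∧ (∃ C, ∀ t, ‖g t‖ ≤ C) ∧
    (∀ t ∈ Set.Icc 0 ℓ, ‖direction V g t‖ = 1) ∧ direction V g ℓ = W ∧
    ∫ t in (0 : ℝ)..ℓ, direction V g t = D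

theorem intervalIntegrable_of_bounded {E : Type*} [NormedAddCommGroup E] {g : ℝ → E}
    (hg : StronglyMeasurable g) (hb : ∃ C, ∀ t, ‖g t‖ ≤ C) (a b : ℝ) :
    IntervalIntegrable g volume a b := by
  obtain ⟨C, hC⟩ := hb
  exact (intervalIntegrable_const (c := C)).mono_fun hg.aestronglyMeasurable
    (Filter.Eventually.of_forall fun t => (hC t).trans (le_abs_self C))

theorem continuous_direction {V : Euc n} {g : ℝ → Euc n} (hg : StronglyMeasurable g)
    (hb : ∃ C, ∀ t, ‖g t‖ ≤ C) : Continuous (direction V g) :=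
  continuous_const.add (intervalIntegral.continuous_primitive
    (fun a b => intervalIntegrable_of_bounded hg hb a b) 0)

namespace Joins

/-- Gluing the derivatives of the tangents, rather than the curves, makes the tangent continuous
across the junction by construction. -/
theorem trans {V W X D D' : Euc n} {ℓ ℓ' : ℝ} (h : Joins V W D ℓ) (h' : Joins W X D' ℓ') :
    Joins V X (D + D') (ℓ + ℓ') := by
  obtain ⟨hℓ, g, hg, hgb, hu, hW, hD⟩ := h
  obtain ⟨hℓ', g', hg', hgb', hu', hX, hD'⟩ := h'
  let f : ℝ → Euc n := fun t => if t ≤ ℓ then g t else g' (t - ℓ)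
  have hf : StronglyMeasurable f := StronglyMeasurable.ite measurableSet_Iic hg
    (hg'.comp_measurable (measurable_id.sub_const ℓ))
  have hfb : ∃ C, ∀ t, ‖f t‖ ≤ C := by
    obtain ⟨C, hC⟩ := hgb
    obtain ⟨C', hC'⟩ := hgb'
    refine ⟨max C C', fun t => ?_⟩
    by_cases ht : t ≤ ℓ
    · simp only [f, if_pos ht]; exact (hC t).trans (le_max_left _ _)
    · simp only [f, if_neg ht]; exact (hC' _).trans (le_max_right _ _)
  have hii := intervalIntegrable_of_bounded hf hfb
  have h1 : ∀ t ∈ Set.Icc 0 ℓ, direction V f t = direction V g t := by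
    intro t ht
    rw [direction, direction]
    congr 1
    refine intervalIntegral.integral_congr fun s hs => ?_
    rw [Set.uIcc_of_le ht.1] at hs
    exact if_pos (hs.2.trans ht.2)
  have h2 : ∀ t, ℓ ≤ t → direction V f t = direction W g' (t - ℓ) := by
    intro t ht
    have e : ∫ s in ℓ..t, f s = ∫ s in (0 : ℝ)..(t - ℓ), g' s := by
      rw [← sub_self ℓ, ← intervalIntegral.integral_comp_sub_right g' ℓ]
      refine intervalIntegral.integral_congr_ae (Filter.Eventually.of_forall fun s hs => ?_)
      rw [Set.uIoc_of_le ht] at hs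
      exact if_neg (not_le.2 hs.1)
    have e' := h1 ℓ ⟨hℓ, le_rfl⟩
    rw [hW] at e'
    rw [direction, ← intervalIntegral.integral_add_adjacent_intervals (hii 0 ℓ) (hii ℓ t), e,
      ← add_assoc]
    rw [direction] at e'
    rw [e', direction]
  have hc := continuous_direction (V := V) hf hfb
  refine ⟨add_nonneg hℓ hℓ', f, hf, hfb, fun t ht => ?_, ?_, ?_⟩
  · rcases le_total t ℓ with h | h
    · rw [h1 t ⟨ht.1, h⟩, hu t ⟨ht.1, h⟩]
    · rw [h2 t h, hu' _ ⟨sub_nonneg.2 h, by linarith [ht.2]⟩]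
  · rw [h2 _ (by linarith), add_sub_cancel_left, hX]
  · rw [← intervalIntegral.integral_add_adjacent_intervals (hc.intervalIntegrable 0 ℓ)
      (hc.intervalIntegrable ℓ _)]
    congr 1
    · rw [← hD]
      refine intervalIntegral.integral_congr fun t ht => ?_
      rw [Set.uIcc_of_le hℓ] at ht
      exact h1 t ht
    · rw [← hD', intervalIntegral.integral_congr (g := fun t => direction W g' (t - ℓ)),
        intervalIntegral.integral_comp_sub_right (direction W g') ℓ, sub_self, add_sub_cancel_left]
      intro t ht
      rw [Set.uIcc_of_le (by linarith)] at ht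
      exact h2 t ht.1

/-- A straight segment. -/
theorem segment {V : Euc n} (hV : ‖V‖ = 1) {τ : ℝ} (hτ : 0 ≤ τ) : Joins V V (τ • V) τ :=
  ⟨hτ, fun _ => 0, stronglyMeasurable_const, ⟨0, by simp⟩, by simp [direction, hV],
    by simp [direction], by simp [direction]⟩

theorem norm_cos_smul_add_sin_smul {a w : Euc n} (ha : ‖a‖ = 1) (hw : ‖w‖ = 1)
    (haw : inner ℝ a w = 0) (θ : ℝ) : ‖Real.cos θ • a + Real.sin θ • w‖ = 1 := by
  rw [← sq_eq_sq₀ (norm_nonneg _) zero_le_one, norm_add_sq_real, inner_smul_left,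
    inner_smul_right, haw, norm_smul, norm_smul, ha, hw]
  simp

/-- A circular arc of radius one. -/
theorem arc {a w : Euc n} (ha : ‖a‖ = 1) (hw : ‖w‖ = 1) (haw : inner ℝ a w = 0) {θ : ℝ}
    (hθ : 0 ≤ θ) : Joins a (Real.cos θ • a + Real.sin θ • w)
      (Real.sin θ • a + (1 - Real.cos θ) • w) θ := by
  have hdir : ∀ t, direction a (fun t => (-Real.sin t) • a + Real.cos t • w) t =
      Real.cos t • a + Real.sin t • w := by
    intro t
    rw [direction, intervalIntegral.integral_add
      ((by fun_prop : Continuous fun t => (-Real.sin t) • a).intervalIntegrable _ _)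
      ((by fun_prop : Continuous fun t => Real.cos t • w).intervalIntegrable _ _),
      intervalIntegral.integral_smul_const, intervalIntegral.integral_smul_const,
      intervalIntegral.integral_neg, integral_sin, integral_cos]
    simp only [Real.cos_zero, Real.sin_zero]
    module
  refine ⟨hθ, fun t => (-Real.sin t) • a + Real.cos t • w,
    (by fun_prop : Continuous fun t => (-Real.sin t) • a + Real.cos t • w).stronglyMeasurable,
    ⟨1, fun t => ?_⟩, fun t _ => ?_, hdir θ, ?_⟩
  · have := norm_cos_smul_add_sin_smul ha hw haw (t + Real.pi / 2)
    rw [Real.cos_add_pi_div_two, Real.sin_add_pi_div_two] at this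
    exact this.le
  · rw [hdir, norm_cos_smul_add_sin_smul ha hw haw]
  · simp only [hdir]
    rw [intervalIntegral.integral_add
      ((by fun_prop : Continuous fun t => Real.cos t • a).intervalIntegrable _ _)
      ((by fun_prop : Continuous fun t => Real.sin t • w).intervalIntegrable _ _),
      intervalIntegral.integral_smul_const, intervalIntegral.integral_smul_const,
      integral_sin, integral_cos]
    simp

end Joins

theorem exists_unit_orthogonal (hn : 2 ≤ n) (a : Euc n) :
    ∃ w : Euc n, ‖w‖ = 1 ∧ inner ℝ a w = 0 := by
  have hne : (Submodule.span ℝ {a})ᗮ ≠ ⊥ := by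
    intro h
    rw [Submodule.orthogonal_eq_bot_iff] at h
    have h1 := finrank_span_le_card (R := ℝ) ({a} : Set (Euc n))
    rw [h, finrank_top, finrank_euclideanSpace_fin] at h1
    simp at h1
    omega
  obtain ⟨v, hv, hv0⟩ := Submodule.exists_mem_ne_zero_of_ne_bot hne
  rw [Submodule.mem_orthogonal_singleton_iff_inner_right] at hv
  refine ⟨‖v‖⁻¹ • v, ?_, ?_⟩
  · rw [norm_smul, norm_inv, norm_norm, inv_mul_cancel₀ (norm_ne_zero_iff.2 hv0)]
  · rw [inner_smul_right, hv, mul_zero]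

/-- Any two unit vectors lie on a common great circle. -/
theorem exists_eq_cos_smul_add_sin_smul (hn : 2 ≤ n) {a b : Euc n} (ha : ‖a‖ = 1)
    (hb : ‖b‖ = 1) : ∃ (w : Euc n) (θ : ℝ), ‖w‖ = 1 ∧ inner ℝ a w = 0 ∧ 0 ≤ θ ∧ θ ≤ Real.pi ∧
      b = Real.cos θ • a + Real.sin θ • w := by
  set r := b - (inner ℝ a b : ℝ) • a with hr
  have har : inner ℝ a r = 0 := by
    rw [hr, inner_sub_right, inner_smul_right, real_inner_self_eq_norm_sq, ha]; simp
  have hnr : ‖r‖ ^ 2 = 1 - (inner ℝ a b) ^ 2 := by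
    rw [hr, norm_sub_sq_real, inner_smul_right, real_inner_comm, norm_smul, ha, hb, mul_one,
      Real.norm_eq_abs, sq_abs]
    ring
  obtain ⟨w, hw, haw, hrw⟩ : ∃ w : Euc n, ‖w‖ = 1 ∧ inner ℝ a w = 0 ∧ r = ‖r‖ • w := by
    by_cases h0 : r = 0
    · obtain ⟨w, hw, haw⟩ := exists_unit_orthogonal hn a
      exact ⟨w, hw, haw, by simp [h0]⟩
    · have h0' := norm_ne_zero_iff.2 h0
      refine ⟨‖r‖⁻¹ • r, ?_, ?_, ?_⟩
      · rw [norm_smul, norm_inv, norm_norm, inv_mul_cancel₀ h0']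
      · rw [inner_smul_right, har, mul_zero]
      · rw [smul_smul, mul_inv_cancel₀ h0', one_smul]
  have hab : |inner ℝ a b| ≤ 1 := by
    have := abs_real_inner_le_norm a b
    rwa [ha, hb, one_mul] at this
  refine ⟨w, Real.arccos (inner ℝ a b), hw, haw, Real.arccos_nonneg _, Real.arccos_le_pi _, ?_⟩
  rw [Real.cos_arccos (abs_le.1 hab).1 (abs_le.1 hab).2, Real.sin_arccos, ← hnr,
    Real.sqrt_sq (norm_nonneg _), ← hrw, hr]
  abel

/-- Every displacement is realized by stopping once along a full great circle of tangents. -/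
theorem exists_joins_self (hn : 2 ≤ n) {W : Euc n} (hW : ‖W‖ = 1) (D : Euc n) :
    ∃ ℓ, 0 < ℓ ∧ Joins W W D ℓ := by
  obtain ⟨e, he, hDe⟩ : ∃ e : Euc n, ‖e‖ = 1 ∧ D = ‖D‖ • e := by
    by_cases h0 : D = 0
    · exact ⟨W, hW, by simp [h0]⟩
    · have h0' := norm_ne_zero_iff.2 h0
      exact ⟨‖D‖⁻¹ • D, by rw [norm_smul, norm_inv, norm_norm, inv_mul_cancel₀ h0'],
        by rw [smul_smul, mul_inv_cancel₀ h0', one_smul]⟩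
  obtain ⟨w, θ, hw, hWw, hθ, hθπ, rfl⟩ := exists_eq_cos_smul_add_sin_smul hn hW he
  have j₂ := Joins.arc hW hw hWw hθ
  have j₃ := Joins.segment he (norm_nonneg D)
  have hw' : ‖(-Real.sin θ) • W + Real.cos θ • w‖ = 1 := by
    have := Joins.norm_cos_smul_add_sin_smul hW hw hWw (θ + Real.pi / 2)
    rwa [Real.cos_add_pi_div_two, Real.sin_add_pi_div_two] at this
  have hew' : inner ℝ (Real.cos θ • W + Real.sin θ • w)
      ((-Real.sin θ) • W + Real.cos θ • w) = 0 := by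
    simp only [inner_add_left, inner_add_right, inner_smul_left, inner_smul_right, hWw,
      real_inner_comm W w, real_inner_self_eq_norm_sq, hW, hw]
    simp
    ring
  -- After the segment in direction `e`, the tangent continues around the same great circle through
  -- the remaining angle and returns to `W`.
  have j₄ := Joins.arc he hw' hew' (θ := 2 * Real.pi - θ) (by linarith [Real.pi_pos])
  rw [Real.cos_two_pi_sub, Real.sin_two_pi_sub] at j₄
  have hback : Real.cos θ • (Real.cos θ • W + Real.sin θ • w) +
      (-Real.sin θ) • ((-Real.sin θ) • W + Real.cos θ • w) = W := by
    match_scalars <;> linarith [Real.sin_sq_add_cos_sq θ]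
  -- The two arcs together make up one full unit circle, so their displacements cancel and only the
  -- segment contributes `D`.
  have hloop : (Real.sin θ • W + (1 - Real.cos θ) • w) +
      ((-Real.sin θ) • (Real.cos θ • W + Real.sin θ • w) +
        (1 - Real.cos θ) • ((-Real.sin θ) • W + Real.cos θ • w)) = 0 := by
    match_scalars <;> linarith [Real.sin_sq_add_cos_sq θ]
  rw [hback] at j₄
  have j := (j₂.trans j₃).trans j₄
  rw [← hDe, add_right_comm, hloop, zero_add] at j
  exact ⟨_, by linarith [Real.pi_pos, norm_nonneg D], j⟩

/-- An arc first turns `V` into `W`; a curve from `W` back to `W` then supplies whatever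
displacement is still missing. -/
theorem exists_joins (hn : 2 ≤ n) {V W : Euc n} (hV : ‖V‖ = 1) (hW : ‖W‖ = 1) (D : Euc n) :
    ∃ ℓ, 0 < ℓ ∧ Joins V W D ℓ := by
  obtain ⟨w, θ, hw, hVw, hθ, -, rfl⟩ := exists_eq_cos_smul_add_sin_smul hn hV hW
  obtain ⟨ℓ, hℓ, j⟩ := exists_joins_self hn hW
    (D - (Real.sin θ • V + (1 - Real.cos θ) • w))
  refine ⟨θ + ℓ, by positivity, ?_⟩
  have := (Joins.arc hV hw hVw hθ).trans j
  rwa [add_sub_cancel] at this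

/-! ### The reduced problem and existence of minimizers -/

/-- Speeds and tangent derivatives of the admissible curves. -/
def reducedAdmissible (Γ : ClampedDatum n) : Set (ℝ × L2I n) :=
  {p | 0 < p.1 ∧ (∀ x ∈ clI, ‖Γ.V₀ + primitiveCLM n x p.2‖ = 1) ∧
    Γ.V₀ + primitiveCLM n 1 p.2 = Γ.V₁ ∧ p.1 • (Γ.V₀ + meanPrimitiveCLM n p.2) = Γ.P₁ - Γ.P₀}

theorem add_primitiveCLM_eq_direction (c : Euc n) (g : L2I n) {x : ℝ} (hx : x ∈ clI) :
    c + primitiveCLM n x g = direction c g x := by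
  rw [primitiveCLM_apply hx, direction]

theorem add_meanPrimitiveCLM_eq (c : Euc n) (g : L2I n) :
    c + meanPrimitiveCLM n g = ∫ x in (0 : ℝ)..1, direction c g x := by
  have h : ∫ x in (0 : ℝ)..1, direction c g x = ∫ x in (0 : ℝ)..1, (c + primitiveCLM n x g) := by
    refine intervalIntegral.integral_congr fun x hx => ?_
    rw [Set.uIcc_of_le zero_le_one] at hx
    exact (add_primitiveCLM_eq_direction c g hx).symm
  rw [h, intervalIntegral.integral_add intervalIntegrable_const
    (intervalIntegrable_primitiveCLM g), meanPrimitiveCLM_apply]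
  simp

theorem integral_norm_sq_eq (g : L2I n) : ∫ x in I, ‖g x‖ ^ 2 = ‖g‖ ^ 2 := by
  rw [← real_inner_self_eq_norm_sq, L2.inner_def]
  simp only [real_inner_self_eq_norm_sq]

/-- The curve starting from `P` with speed `L` and tangent `direction c g`. -/
noncomputable def curveOf (P : Euc n) (L : ℝ) (c : Euc n) (g : ℝ → Euc n) (x : ℝ) : Euc n :=
  P + L • ∫ t in (0 : ℝ)..x, direction c g t

theorem curveOf_zero (P : Euc n) (L : ℝ) (c : Euc n) (g : ℝ → Euc n) : curveOf P L c g 0 = P := by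
  simp [curveOf]

theorem represents_curveOf (P : Euc n) {L : ℝ} {c : Euc n} {g : ℝ → Euc n} (hL : 0 < L)
    (hg : MemLp g 2 (volume.restrict I)) (hu : ∀ x ∈ clI, ‖direction c g x‖ = 1) :
    Represents (curveOf P L c g) L c g :=
  ⟨hL, hg, hu, fun x _ => by rw [curveOf_zero, curveOf]⟩

theorem direction_congr_ae {c : Euc n} {g g' : ℝ → Euc n} (h : g =ᵐ[volume.restrict I] g')
    {x : ℝ} (hx : x ∈ clI) : direction c g x = direction c g' x := by
  rw [direction, direction, intervalIntegral.integral_of_le hx.1,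
    intervalIntegral.integral_of_le hx.1, integral_Ioc_eq_integral_Ioo,
    integral_Ioc_eq_integral_Ioo]
  congr 1
  exact integral_congr_ae (ae_restrict_of_ae_restrict_of_subset (Set.Ioo_subset_Ioo le_rfl hx.2) h)

theorem mk_toLp_mem_reducedAdmissible {Γ : ClampedDatum n} {L : ℝ} {g : ℝ → Euc n} (hL : 0 < L)
    (hg : MemLp g 2 (volume.restrict I)) (hu : ∀ x ∈ clI, ‖direction Γ.V₀ g x‖ = 1)
    (h1 : direction Γ.V₀ g 1 = Γ.V₁)
    (h2 : L • ∫ t in (0 : ℝ)..1, direction Γ.V₀ g t = Γ.P₁ - Γ.P₀) :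
    (L, hg.toLp g) ∈ reducedAdmissible Γ := by
  have e : ∀ x ∈ clI, direction Γ.V₀ (hg.toLp g) x = direction Γ.V₀ g x := fun x hx =>
    direction_congr_ae hg.coeFn_toLp hx
  refine ⟨hL, fun x hx => ?_, ?_, ?_⟩
  · rw [add_primitiveCLM_eq_direction _ _ hx, e x hx, hu x hx]
  · rw [add_primitiveCLM_eq_direction _ _ (by simp), e 1 (by simp), h1]
  · rw [add_meanPrimitiveCLM_eq, ← h2]
    congr 1
    refine intervalIntegral.integral_congr fun x hx => ?_
    rw [Set.uIcc_of_le zero_le_one] at hx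
    exact e x hx

theorem reducedAdmissible_nonempty (hn : 2 ≤ n) (Γ : ClampedDatum n) :
    (reducedAdmissible Γ).Nonempty := by
  obtain ⟨ℓ, hℓ, -, g, hg, hgb, hu, h1, h2⟩ :=
    exists_joins hn Γ.norm_V₀ Γ.norm_V₁ (Γ.P₁ - Γ.P₀)
  -- Rescaling arclength from `[0, ℓ]` to `[0,1]` multiplies the tangent derivative by `ℓ`.
  have hdir : ∀ x, direction Γ.V₀ (fun t => ℓ • g (ℓ * t)) x = direction Γ.V₀ g (ℓ * x) := by
    intro x
    rw [direction, direction, intervalIntegral.integral_smul,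
      intervalIntegral.smul_integral_comp_mul_left, mul_zero]
  have hmem : MemLp (fun t => ℓ • g (ℓ * t)) 2 (volume.restrict I) := by
    obtain ⟨C, hC⟩ := hgb
    exact (MemLp.of_bound (hg.comp_measurable (measurable_const_mul ℓ)).aestronglyMeasurable C
      (Filter.Eventually.of_forall fun t => hC _)).const_smul ℓ
  refine ⟨_, mk_toLp_mem_reducedAdmissible hℓ hmem (fun x hx => ?_) ?_ ?_⟩
  · rw [hdir]
    exact hu _ ⟨mul_nonneg hℓ.le hx.1, mul_le_of_le_one_right hℓ.le hx.2⟩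
  · rw [hdir, mul_one, h1]
  · simp only [hdir]
    rw [intervalIntegral.smul_integral_comp_mul_left, mul_zero, mul_one, h2]

theorem exists_isMinimizer (hn : 2 ≤ n) (Γ : ClampedDatum n) {lam : ℝ} (hlam : 0 < lam) :
    ∃ γ : ℝ → Euc n, IsMinimizer Γ lam γ := by
  obtain ⟨⟨L, g⟩, ⟨hL, hu, h1, h2⟩, hmin⟩ := exists_min_reducedEnergy (primitiveCLM n)
    (meanPrimitiveCLM n) norm_meanPrimitiveCLM_apply_le Γ.norm_V₀ hlam
    (S := reducedAdmissible Γ) rfl (reducedAdmissible_nonempty hn Γ)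
  have hrep : Represents (curveOf Γ.P₀ L Γ.V₀ g) L Γ.V₀ g :=
    represents_curveOf Γ.P₀ hL (Lp.memLp g) fun x hx => by
      rw [← add_primitiveCLM_eq_direction _ _ hx]; exact hu x hx
  refine ⟨_, hrep.mem_admissible (curveOf_zero _ _ _ _) ?_ ?_, fun η hη => ?_⟩
  · rw [← add_primitiveCLM_eq_direction _ _ (by simp)]; exact h1
  · rw [← add_meanPrimitiveCLM_eq]; exact h2
  · obtain ⟨L', g', hrep', h1', h2'⟩ := exists_represents hη
    have := hmin _ (mk_toLp_mem_reducedAdmissible hrep'.pos hrep'.memLp hrep'.unit h1' h2')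
    rw [reducedEnergy, reducedEnergy, ← integral_norm_sq_eq, ← integral_norm_sq_eq] at this
    rw [hrep.energy_eq, hrep'.energy_eq]
    refine this.trans_eq ?_
    congr 2
    refine integral_congr_ae ?_
    filter_upwards [hrep'.memLp.coeFn_toLp] with x hx
    rw [hx]

/-! ### Circles and the sharp bound for closed curves -/

/-- The derivative of the tangent of a once-covered circle. -/
noncomputable def circleAcceleration (u w : Euc n) (x : ℝ) : Euc n :=
  (2 * Real.pi) • ((-Real.cos (2 * Real.pi * x)) • u + (-Real.sin (2 * Real.pi * x)) • w)

theorem continuous_circleAcceleration (u w : Euc n) : Continuous (circleAcceleration u w) := by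
  unfold circleAcceleration; fun_prop

theorem norm_circleAcceleration {u w : Euc n} (hu : ‖u‖ = 1) (hw : ‖w‖ = 1)
    (huw : inner ℝ u w = 0) (x : ℝ) : ‖circleAcceleration u w x‖ = 2 * Real.pi := by
  have h := Joins.norm_cos_smul_add_sin_smul hu hw huw (2 * Real.pi * x + Real.pi)
  rw [Real.cos_add_pi, Real.sin_add_pi] at h
  rw [circleAcceleration, norm_smul, h, mul_one, Real.norm_of_nonneg (by positivity)]

theorem direction_circleAcceleration (u w : Euc n) (x : ℝ) :
    direction w (circleAcceleration u w) x =
      (-Real.sin (2 * Real.pi * x)) • u + Real.cos (2 * Real.pi * x) • w := by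
  have h : ∀ x, HasDerivAt (fun x : ℝ => (-Real.sin (2 * Real.pi * x)) • u +
      Real.cos (2 * Real.pi * x) • w) (circleAcceleration u w x) x := by
    intro x
    have hl : HasDerivAt (fun x : ℝ => 2 * Real.pi * x) (2 * Real.pi) x := by
      simpa using (hasDerivAt_id x).const_mul (2 * Real.pi)
    convert! (hl.sin.neg.smul_const u).add (hl.cos.smul_const w) using 1
    rw [circleAcceleration]
    module
  rw [direction, intervalIntegral.integral_eq_sub_of_hasDerivAt (fun x _ => h x)
    ((continuous_circleAcceleration u w).intervalIntegrable _ _)]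
  simp

theorem represents_circle {r : ℝ} (hr : 0 < r) {γ : ℝ → Euc n} {c u w : Euc n} (hu : ‖u‖ = 1)
    (hw : ‖w‖ = 1) (huw : inner ℝ u w = 0)
    (hγ : ∀ x ∈ clI, γ x =
      c + (r * Real.cos (2 * Real.pi * x)) • u + (r * Real.sin (2 * Real.pi * x)) • w) :
    Represents γ (2 * Real.pi * r) w (circleAcceleration u w) := by
  refine ⟨by positivity, memLp_I_of_continuousOn (continuous_circleAcceleration u w).continuousOn,
    fun x _ => ?_, fun x hx => ?_⟩
  · have h := Joins.norm_cos_smul_add_sin_smul hu hw huw (2 * Real.pi * x + Real.pi / 2)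
    rw [Real.cos_add_pi_div_two, Real.sin_add_pi_div_two] at h
    rw [direction_circleAcceleration, h]
  · have h : ∀ x, HasDerivAt (fun x : ℝ => (r * Real.cos (2 * Real.pi * x)) • u +
        (r * Real.sin (2 * Real.pi * x)) • w)
        ((2 * Real.pi * r) • direction w (circleAcceleration u w) x) x := by
      intro x
      have hl : HasDerivAt (fun x : ℝ => 2 * Real.pi * x) (2 * Real.pi) x := by
        simpa using (hasDerivAt_id x).const_mul (2 * Real.pi)
      convert! ((hl.cos.const_mul r).smul_const u).add ((hl.sin.const_mul r).smul_const w) using 1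
      rw [direction_circleAcceleration]
      module
    have hc : Continuous fun x => (2 * Real.pi * r) • direction w (circleAcceleration u w) x := by
      simp only [direction_circleAcceleration]; fun_prop
    rw [← intervalIntegral.integral_smul,
      intervalIntegral.integral_eq_sub_of_hasDerivAt (fun x _ => h x)
      (hc.intervalIntegrable _ _), hγ x hx, hγ 0 (by simp)]
    simp
    abel

theorem energy_circle {lam : ℝ} (hlam : 0 < lam) {γ : ℝ → Euc n}
    (hγ : IsCircle (1 / √lam) γ) : energy lam γ = 4 * Real.pi * √lam := by
  obtain ⟨c, u, w, hu, hw, huw, hγ⟩ := hγ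
  have hs : 0 < √lam := Real.sqrt_pos.2 hlam
  have hrep := represents_circle (by positivity) hu hw huw hγ
  rw [hrep.energy_eq]
  simp only [norm_circleAcceleration hu hw huw]
  have hpi := Real.pi_pos
  simp only [integral_const, MeasurableSet.univ, measureReal_restrict_apply, Set.univ_inter,
    Real.volume_real_Ioo, sub_zero, smul_eq_mul]
  norm_num
  field_simp
  rw [Real.sq_sqrt hlam.le]
  ring

/-- Energy bound for closed curves. -/
theorem energy_lower_bound_of_closed {Γ : ClampedDatum n} (hP : Γ.P₀ = Γ.P₁) (hV : Γ.V₀ = Γ.V₁)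
    {lam : ℝ} (hlam : 0 < lam) {η : ℝ → Euc n} (hη : η ∈ admissible Γ) :
    4 * Real.pi * √lam ≤ energy lam η := by
  obtain ⟨L, g, hrep, h1, h2⟩ := exists_represents hη
  have hL := hrep.pos
  -- Applied to the tangent: `V₀ = V₁` makes it periodic, and `P₀ = P₁` makes its mean vanish.
  have hW := wirtinger Γ.V₀ hrep.memLp (f := direction Γ.V₀ g) (fun x _ => rfl)
    (by rw [direction, ← hV] at h1; exact add_eq_left.1 h1)
    (by rw [hP, sub_self, smul_eq_zero, or_iff_right hL.ne'] at h2; exact h2)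
  have e : ∫ x in I, ‖direction Γ.V₀ g x‖ ^ 2 = 1 := by
    rw [setIntegral_congr_fun (g := fun _ => (1 : ℝ)) measurableSet_Ioo fun x hx => by
      simp only [hrep.unit x (Set.Ioo_subset_Icc_self hx), one_pow]]
    simp
  rw [e, mul_one] at hW
  rw [hrep.energy_eq]
  have h3 : L⁻¹ * (4 * Real.pi ^ 2) ≤ L⁻¹ * ∫ x in I, ‖g x‖ ^ 2 := by gcongr
  -- The arithmetic–geometric mean inequality, by completing the square; equality holds at `L = 2π /
  -- √λ`, the length of the circle.
  have h4 : 4 * Real.pi * √lam ≤ L⁻¹ * (4 * Real.pi ^ 2) + lam * L := by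
    have hs := Real.sq_sqrt hlam.le
    have : L⁻¹ * (4 * Real.pi ^ 2) + lam * L - 4 * Real.pi * √lam =
        L⁻¹ * (2 * Real.pi - √lam * L) ^ 2 := by
      field_simp
      ring_nf
      rw [hs]
    have : 0 ≤ L⁻¹ * (2 * Real.pi - √lam * L) ^ 2 := by positivity
    linarith
  linarith

theorem exists_circle_mem_admissible (hn : 2 ≤ n) {Γ : ClampedDatum n} (hP : Γ.P₀ = Γ.P₁)
    (hV : Γ.V₀ = Γ.V₁) {r : ℝ} (hr : 0 < r) : ∃ γ ∈ admissible Γ, IsCircle r γ := by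
  obtain ⟨u, hu, hVu⟩ := exists_unit_orthogonal hn Γ.V₀
  rw [real_inner_comm] at hVu
  -- The centre `P₀ - r u`, with `u ⊥ V₀`, puts the starting point at `P₀` and the initial tangent
  -- along `V₀`.
  let γ : ℝ → Euc n := fun x => (Γ.P₀ - r • u) + (r * Real.cos (2 * Real.pi * x)) • u +
    (r * Real.sin (2 * Real.pi * x)) • Γ.V₀
  have hrep := represents_circle hr (γ := γ) hu Γ.norm_V₀ hVu fun x _ => rfl
  have h0 : γ 0 = Γ.P₀ := by simp [γ]
  have h1 : γ 1 = Γ.P₀ := by simp [γ]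
  refine ⟨γ, hrep.mem_admissible h0 ?_ ?_, _, u, Γ.V₀, hu, Γ.norm_V₀, hVu, fun x _ => rfl⟩
  · rw [direction_circleAcceleration, ← hV]; simp
  · have := hrep.curve 1 (by simp)
    rw [h0, h1] at this
    rw [← hP, sub_self]
    exact left_eq_add.1 this

end Elastica

theorem theorem3p7 (n : ℕ) (hn : 2 ≤ n) (Γ : Elastica.ClampedDatum n) (lam : ℝ)
    (hlam : 0 < lam) :
    (∃ γ : ℝ → Elastica.Euc n, Elastica.IsMinimizer Γ lam γ) ∧
    (Γ.P₀ = Γ.P₁ → Γ.V₀ = Γ.V₁ →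
      (∃ γ ∈ Elastica.admissible Γ, Elastica.IsCircle (1 / √lam) γ) ∧
      ∀ γ ∈ Elastica.admissible Γ, Elastica.IsCircle (1 / √lam) γ →
        Elastica.IsMinimizer Γ lam γ) := by
  refine ⟨Elastica.exists_isMinimizer hn Γ hlam, fun hP hV => ⟨?_, fun γ hγ hc => ⟨hγ, ?_⟩⟩⟩
  · exact Elastica.exists_circle_mem_admissible hn hP hV
      (one_div_pos.2 (Real.sqrt_pos.2 hlam))
  · intro η hη
    rw [Elastica.energy_circle hlam hc]
    exact Elastica.energy_lower_bound_of_closed hP hV hlam hη
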